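/- Let $N_R\ge 1$ and $N_s\ge 2$ be integers and let $\gamma>0$. For integers $n_1,n_2\ge1$ and $\lambda\ge 0$ let $F(\,\cdot\,|\,n_1,n_2,\lambda)$ be the cumulative distribution function of the noncentral $F$-distribution with $n_1$ and $n_2$ degrees of freedom and noncentrality parameter $\lambda$, i.e. of $\frac{U/n_1}{V/n_2}$, where $U$ is noncentral chi-square with $n_1$ degrees of freedom and noncentrality $\lambda$ (the sum of squares of $n_1$ independent unit-variance real Gaussians whose squared means sum to $\lambda$), and $V$ is an independent central chi-square variable with $n_2$ degrees of freedom. For $\eta>0$ and integers $L\ge1$ put $$p_{miss}=p_{miss}(L,\eta)=F\big((N_s-1)\gamma\,\big|\,2N_RL,\ 2N_RL(N_s-1),\ L\eta\big),$$ that is, $p_{miss}=\Pr\{U\le\gamma V\}$ with $n_1=2N_RL$, $n_2=2N_RL(N_s-1)$ and $\lambda=L\eta$. Then, for every fixed $\eta>0$: 1. The equation $$\frac{\gamma+1}{\eta\gamma}\,(x^2-N_R^2)-x-N_R-2N_R(N_s-1)=0$$ has exactly one solution $x^*>0$. Put $v^*=\dfrac{x^{*2}-N_R^2}{\eta\gamma}$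 and $$I^*(\eta,\gamma)=\frac{\eta}{2}\left(1-\frac{\gamma v^*}{N_R+\sqrt{N_R^2+\gamma\eta v^*}}\right)+N_R(N_s-1)\log\frac{2N_R(N_s-1)}{v^*}-N_R\log\frac{\gamma v^*}{N_R+\sqrt{N_R^2+\gamma\eta v^*}}.$$ 2. $p_{miss}>0$ for every $L\ge1$, and $$\lim_{L\to\infty}-\frac1L\log p_{miss}=\begin{cases}I^*(\eta,\gamma), & \gamma<\dfrac{2N_R+\eta}{2N_R(N_s-1)},\\[2mm] 0, & \text{otherwise.}\end{cases}$$ Moreover, for fixed $N_R,N_s,\gamma$, the function $\eta\mapsto I^*(\eta,\gamma)$ is strictly increasing on $\left\{\eta>0:\gamma<\frac{2N_R+\eta}{2N_R(N_s-1)}\right\}$. -/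

import Mathlib

noncomputable section

namespace MissDetection

/-- The noncentral chi-square distribution with `n` degrees of freedom and noncentrality
parameter `lam`: the law of `∑ i, Z i ^ 2`, where the `Z i`, `i = 1, …, n`, are independent with
`Z i ∼ N(μ i, 1)` and `∑ i, μ i ^ 2 = lam`. By rotation invariance the law depends on the means
only through `lam`; they are taken to be all equal to `√(lam / n)`. For `lam = 0` it is the
central chi-square distribution. -/
def noncentralChiSq (n : ℕ) (lam : ℝ) : MeasureTheory.Measure ℝ :=
  (MeasureTheory.Measure.pi
    (fun _ : Fin n => ProbabilityTheory.gaussianReal (Real.sqrt (lam / n)) 1)).map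
    (fun z => ∑ i, z i ^ 2)

instance (n : ℕ) (lam : ℝ) :
    MeasureTheory.IsProbabilityMeasure (noncentralChiSq n lam) :=
  MeasureTheory.Measure.isProbabilityMeasure_map
    (Measurable.aemeasurable (by fun_prop))

/-- The noncentral F-distribution with `n₁` and `n₂` degrees of freedom and noncentrality
parameter `lam`: the law of `(U / n₁) / (V / n₂)` for independent `U ∼ χ²_{n₁}(lam)` and
`V ∼ χ²_{n₂}`. -/
def noncentralF (n₁ n₂ : ℕ) (lam : ℝ) : MeasureTheory.Measure ℝ :=
  ((noncentralChiSq n₁ lam).prod (noncentralChiSq n₂ 0)).map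
    (fun p => (p.1 / n₁) / (p.2 / n₂))

instance (n₁ n₂ : ℕ) (lam : ℝ) :
    MeasureTheory.IsProbabilityMeasure (noncentralF n₁ n₂ lam) :=
  MeasureTheory.Measure.isProbabilityMeasure_map
    (Measurable.aemeasurable (by fun_prop))

/-- The miss-detection probability over `L` slots, `Pr(L_G ≤ γ)`, where `(N_s - 1) L_G` has the
noncentral F-distribution with `2 N_R L` and `2 N_R L (N_s - 1)` degrees of freedom and
noncentrality parameter `L η`. -/
def missProb (NR Ns : ℕ) (γ η : ℝ) (L : ℕ) : ℝ :=
  ProbabilityTheory.cdf (noncentralF (2 * NR * L) (2 * NR * L * (Ns - 1)) (L * η))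
    (((Ns : ℝ) - 1) * γ)

/-- The critical value of the threshold `γ`. -/
def criticalThreshold (NR Ns : ℕ) (η : ℝ) : ℝ :=
  (2 * NR + η) / (2 * NR * ((Ns : ℝ) - 1))

/-- `x` is a positive solution of the quadratic equation that determines the rate function. -/
def IsRateRoot (NR Ns : ℕ) (γ η x : ℝ) : Prop :=
  0 < x ∧
    (γ + 1) / (η * γ) * (x ^ 2 - (NR : ℝ) ^ 2) - x - NR - 2 * NR * ((Ns : ℝ) - 1) = 0

/-- `x*`: a positive solution of the quadratic equation. -/
def xStar (NR Ns : ℕ) (γ η : ℝ) : ℝ :=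
  Classical.epsilon (IsRateRoot NR Ns γ η)

/-- `v* = (x*² - N_R²) / (η γ)`. -/
def vStar (NR Ns : ℕ) (γ η : ℝ) : ℝ :=
  (xStar NR Ns γ η ^ 2 - (NR : ℝ) ^ 2) / (η * γ)

/-- The rate function `I*(η, γ)`. -/
def rateStar (NR Ns : ℕ) (γ η : ℝ) : ℝ :=
  η / 2 * (1 - γ * vStar NR Ns γ η /
      (NR + Real.sqrt ((NR : ℝ) ^ 2 + γ * η * vStar NR Ns γ η)))
    + NR * ((Ns : ℝ) - 1) * Real.log (2 * NR * ((Ns : ℝ) - 1) / vStar NR Ns γ η)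
    - NR * Real.log (γ * vStar NR Ns γ η /
      (NR + Real.sqrt ((NR : ℝ) ^ 2 + γ * η * vStar NR Ns γ η)))

end MissDetection

end

/-!
Both `U` and `V` are sums over the `L` slots of independent variables of the same law, so `U - γ V`
has moment generating function `exp (L * Λ s)` on an open interval around `0`, where `Λ` is
`slotCgf`, the cumulant generating function of a single slot (`mgf_slotLaw`). Since `V > 0` almost
surely, the miss probability is the probability that `U - γ V ≤ 0` (`missProb_eq`), and its decay
rate is given by Cramér's theorem, proved here for sequences of laws whose cumulant generating
function is exactly `L * Λ` (`tendsto_neg_log_measureReal_nonpos`): Chernoff's bound from above;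
from below, exponential tilting, with Chebyshev's inequality for the tilted law.

The rate is minus the minimum of the convex function `Λ` over `s ≤ 0`. In terms of
`x = N_R + η / (1 - 2 * s)`, the equation `Λ' s = 0` is the quadratic rate equation, whose positive
root `x*` thus gives the critical point `critPoint` (`slotCgfDeriv_critPoint`), and `-Λ` there is
the closed form `I*` (`rateStar_eq_neg_slotCgf`). The critical point is negative exactly when the
slope of `Λ` at `0` is positive, i.e. when `γ` lies below the critical threshold
(`critPoint_neg_iff`, `lt_criticalThreshold_iff`). Otherwise the minimum over `s ≤ 0` is attained
at `s = 0`, where `Λ` vanishes, and the rate is zero.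

For monotonicity in `η`: at a fixed `s < 0` the value `Λ s` strictly decreases with `η`, hence so
does the minimum over `s` as long as it is attained at a negative point.
-/

open MeasureTheory ProbabilityTheory Filter Topology Set

namespace MissDetection

/-! ### Tail probabilities under exponential tilting -/

section Tilting

variable {Ω : Type*} [MeasurableSpace Ω] {μ : Measure Ω} [IsProbabilityMeasure μ] {X : Ω → ℝ}
  {s : ℝ}

/-- If tilting by `exp (s * X)` makes the mean of `X` negative, then `X ≤ 0` has positive
probability: otherwise `X` would be a.s. positive for the tilted measure as well. -/
theorem measureReal_nonpos_pos (hs : s ∈ interior (integrableExpSet X μ))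
    (hneg : deriv (cgf X μ) s < 0) : 0 < μ.real {ω | X ω ≤ 0} := by
  refine measureReal_nonneg.lt_of_ne' fun h0 => hneg.not_ge ?_
  rw [← integral_tilted_mul_self hs]
  refine integral_nonneg_of_ae ((tilted_absolutelyContinuous μ _).ae_le ?_)
  rw [measureReal_eq_zero_iff] at h0
  filter_upwards [measure_eq_zero_iff_ae_notMem.1 h0] with ω hω
  exact (not_le.1 hω).le

/-- Lower bound for a lower tail by a change of measure. Under the tilted law, `X` has
mean `m = deriv (cgf X μ) s < 0`; Chebyshev's inequality bounds the tilted probability of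
`2 * m < X < 0` from below, and on this event the density of the tilted law is at most
`exp (2 * s * m - cgf X μ s)`. -/
theorem one_sub_mul_exp_le_measureReal_nonpos (hX : Measurable X)
    (hs : s ∈ interior (integrableExpSet X μ)) (hs0 : s ≤ 0)
    (hneg : deriv (cgf X μ) s < 0) :
    (1 - iteratedDeriv 2 (cgf X μ) s / deriv (cgf X μ) s ^ 2) *
      Real.exp (cgf X μ s - 2 * s * deriv (cgf X μ) s) ≤ μ.real {ω | X ω ≤ 0} := by
  set m := deriv (cgf X μ) s
  have hint : Integrable (fun ω => Real.exp (s * X ω)) μ :=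
    interior_subset (s := integrableExpSet X μ) hs
  have hprob : IsProbabilityMeasure (μ.tilted (s * X ·)) := isProbabilityMeasure_tilted hint
  set ν := μ.tilted (s * X ·) with hν
  set A := {ω | 2 * m < X ω ∧ X ω < 0} with hA
  have hAm : MeasurableSet A :=
    (measurableSet_lt measurable_const hX).inter (measurableSet_lt hX measurable_const)
  have hcheb : ν.real {ω | -m ≤ |X ω - m|} ≤ iteratedDeriv 2 (cgf X μ) s / m ^ 2 := by
    have hmem : MemLp X 2 ν := memLp_tilted_mul hs 2
    have h := meas_ge_le_variance_div_sq hmem (neg_pos.2 hneg)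
    rw [hν, integral_tilted_mul_self hs, variance_tilted_mul hs, neg_sq] at h
    refine ENNReal.toReal_le_of_le_ofReal ?_ h
    rw [← variance_tilted_mul hs]
    exact div_nonneg (variance_nonneg _ _) (sq_nonneg _)
  have hcompl : Aᶜ = {ω | -m ≤ |X ω - m|} := by
    ext ω
    simp only [hA, mem_compl_iff, mem_ofPred_eq, le_abs]
    constructor
    · intro h
      by_contra! h'
      exact h ⟨by linarith, by linarith⟩
    · rintro (h | h) ⟨h1, h2⟩ <;> linarith
  have hlow : 1 - iteratedDeriv 2 (cgf X μ) s / m ^ 2 ≤ ν.real A := by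
    have := probReal_add_probReal_compl (μ := ν) hAm
    rw [hcompl] at this
    linarith
  have hup : ν.real A ≤ Real.exp (2 * s * m - cgf X μ s) * μ.real A := by
    have h1 : ν A ≤ ENNReal.ofReal (Real.exp (2 * s * m - cgf X μ s)) * μ A := by
      rw [hν, tilted_mul_apply_cgf' hAm hint, ← setLIntegral_const]
      refine setLIntegral_mono measurable_const fun ω hω => ?_
      refine ENNReal.ofReal_le_ofReal (Real.exp_le_exp.2 ?_)
      have := mul_le_mul_of_nonpos_left hω.1.le hs0
      linarith
    have h2 := ENNReal.toReal_mono (ENNReal.mul_ne_top ENNReal.ofReal_ne_top (by simp)) h1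
    rwa [ENNReal.toReal_mul, ENNReal.toReal_ofReal (Real.exp_pos _).le] at h2
  have hmono : μ.real A ≤ μ.real {ω | X ω ≤ 0} := measureReal_mono fun ω hω => hω.2.le
  calc _ ≤ Real.exp (2 * s * m - cgf X μ s) * μ.real A * Real.exp (cgf X μ s - 2 * s * m) :=
        mul_le_mul_of_nonneg_right (hlow.trans hup) (Real.exp_pos _).le
    _ = μ.real A := by
        rw [mul_right_comm, ← Real.exp_add]
        simp
    _ ≤ _ := hmono

end Tilting

/-! ### The large-deviation limit when the cumulant generating function is linear in `L` -/

section Cramer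

variable {Ω : Type*} [MeasurableSpace Ω] {μ : Measure Ω} {X : Ω → ℝ} {Λ Λ' : ℝ → ℝ} {J : Set ℝ}
  {L : ℝ} {s : ℝ}

theorem mem_interior_integrableExpSet_of_mgf_eq_exp (hJ : IsOpen J)
    (hmgf : ∀ s ∈ J, mgf X μ s = Real.exp (L * Λ s)) (hs : s ∈ J) :
    s ∈ interior (integrableExpSet X μ) := by
  refine mem_interior.2 ⟨J, fun u hu => ?_, hJ, hs⟩
  -- the integral is nonzero, so it is not a junk value
  refine Integrable.of_integral_ne_zero ?_
  have := hmgf u hu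
  rw [mgf] at this
  rw [this]
  positivity

theorem cgf_eventuallyEq_of_mgf_eq_exp (hJ : IsOpen J)
    (hmgf : ∀ s ∈ J, mgf X μ s = Real.exp (L * Λ s)) (hs : s ∈ J) :
    cgf X μ =ᶠ[𝓝 s] fun u => L * Λ u := by
  filter_upwards [hJ.mem_nhds hs] with u hu
  rw [cgf, hmgf u hu, Real.log_exp]

theorem deriv_cgf_of_mgf_eq_exp (hJ : IsOpen J)
    (hmgf : ∀ s ∈ J, mgf X μ s = Real.exp (L * Λ s)) (hs : s ∈ J)
    (hd : HasDerivAt Λ (Λ' s) s) : deriv (cgf X μ) s = L * Λ' s := by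
  rw [(cgf_eventuallyEq_of_mgf_eq_exp hJ hmgf hs).deriv_eq]
  exact (hd.const_mul L).deriv

theorem measureReal_nonpos_pos_of_mgf_eq_exp [IsProbabilityMeasure μ] (hJ : IsOpen J)
    (hmgf : ∀ s ∈ J, mgf X μ s = Real.exp (L * Λ s)) (hL : 0 < L) (hs : s ∈ J)
    (hd : HasDerivAt Λ (Λ' s) s) (hneg : Λ' s < 0) : 0 < μ.real {ω | X ω ≤ 0} := by
  refine measureReal_nonpos_pos (mem_interior_integrableExpSet_of_mgf_eq_exp hJ hmgf hs) ?_
  rw [deriv_cgf_of_mgf_eq_exp hJ hmgf hs hd]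
  exact mul_neg_of_pos_of_neg hL hneg

/-- A one-sided form of Cramér's theorem for laws `μ L` under which `X` has moment generating
function `exp (L * Λ s)`. If the minimum of the convex function `Λ` over `s ≤ 0` is attained
at `s₀` (either at a critical point, or at `s₀ = 0` with nonpositive slope), then
`μ L {X ≤ 0}` decays at the exponential rate `-Λ s₀`. The upper bound is Chernoff's at `s₀`;
the lower bound tilts with `s < s₀`, where `Λ' s < 0`, and lets `s` tend to `s₀`. -/
theorem tendsto_neg_log_measureReal_nonpos {μ : ℕ → Measure Ω} [∀ L, IsProbabilityMeasure (μ L)]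
    (hX : Measurable X) (hJ : IsOpen J)
    (hmgf : ∀ L : ℕ, 1 ≤ L → ∀ s ∈ J, mgf X (μ L) s = Real.exp (L * Λ s))
    (hd : ∀ s ∈ J, HasDerivAt Λ (Λ' s) s) (hmono : StrictMonoOn Λ' J)
    {s₀ : ℝ} (hs₀ : s₀ ∈ J) (hcont : ContinuousAt Λ' s₀) (hle : s₀ ≤ 0) (hslope : Λ' s₀ ≤ 0)
    (hcrit : s₀ * Λ' s₀ = 0) :
    Tendsto (fun L : ℕ => -(1 / (L : ℝ)) * Real.log ((μ L).real {ω | X ω ≤ 0})) atTop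
      (𝓝 (-Λ s₀)) := by
  have hnhds : ∀ᶠ s in 𝓝[<] s₀, s ∈ J ∧ s < s₀ :=
    ((hJ.eventually_mem hs₀).filter_mono nhdsWithin_le_nhds).and self_mem_nhdsWithin
  have hneg : ∀ s ∈ J, s < s₀ → Λ' s < 0 := fun s hs hlt => (hmono hs hs₀ hlt).trans_le hslope
  have hpos : ∀ L : ℕ, 1 ≤ L → 0 < (μ L).real {ω | X ω ≤ 0} := fun L hL => by
    obtain ⟨s, hs, hlt⟩ := hnhds.exists
    exact measureReal_nonpos_pos_of_mgf_eq_exp hJ (hmgf L hL) (by exact_mod_cast hL) hs (hd s hs)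
      (hneg s hs hlt)
  refine tendsto_order.2 ⟨fun a ha => ?_, fun a ha => ?_⟩
  · filter_upwards [eventually_ge_atTop 1] with L hL
    have hL' : (0 : ℝ) < L := by exact_mod_cast hL
    have hint := interior_subset (mem_interior_integrableExpSet_of_mgf_eq_exp hJ (hmgf L hL) hs₀)
    have h := measure_le_le_exp_cgf (μ := μ L) 0 hle hint
    rw [mul_zero, zero_add, cgf, hmgf L hL s₀ hs₀, Real.log_exp] at h
    have hlog := (Real.log_le_iff_le_exp (hpos L hL)).2 h
    refine ha.trans_le ?_
    have := mul_le_mul_of_nonneg_left hlog (by positivity : 0 ≤ 1 / (L : ℝ))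
    have e : 1 / (L : ℝ) * (L * Λ s₀) = Λ s₀ := by field_simp
    linarith
  · have hc : Tendsto (fun s => -Λ s + 2 * s * Λ' s) (𝓝 s₀) (𝓝 (-Λ s₀ + 2 * s₀ * Λ' s₀)) :=
      ((hd s₀ hs₀).continuousAt.neg.add ((continuousAt_const.mul continuousAt_id).mul hcont))
    rw [mul_assoc, hcrit, mul_zero, add_zero] at hc
    obtain ⟨s, ⟨hs, hlt⟩, hsa⟩ :=
      (hnhds.and ((hc.mono_left nhdsWithin_le_nhds).eventually_lt_const ha)).exists
    -- the variance is `L * Λ'' s` and the mean `L * Λ' s`, so the error in Chebyshev is `K / L`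
    set K := iteratedDeriv 2 Λ s / Λ' s ^ 2 with hK
    have hm := hneg s hs hlt
    have h1 : Tendsto (fun L : ℕ => K / (L : ℝ)) atTop (𝓝 0) :=
      tendsto_const_div_atTop_nhds_zero_nat K
    have h2 : Tendsto (fun L : ℕ => Real.log 2 / (L : ℝ) + (-Λ s + 2 * s * Λ' s)) atTop
        (𝓝 (0 + (-Λ s + 2 * s * Λ' s))) :=
      (tendsto_const_div_atTop_nhds_zero_nat _).add_const _
    rw [zero_add] at h2
    filter_upwards [eventually_ge_atTop 1, h1.eventually_lt_const (by norm_num : (0 : ℝ) < 1 / 2),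
      h2.eventually_lt_const hsa] with L hL hKL hfin
    have hL' : (0 : ℝ) < L := by exact_mod_cast hL
    refine lt_of_le_of_lt ?_ hfin
    have hd1 := deriv_cgf_of_mgf_eq_exp hJ (hmgf L hL) hs (hd s hs)
    have hd2 : iteratedDeriv 2 (cgf X (μ L)) s = L * iteratedDeriv 2 Λ s := by
      rw [(cgf_eventuallyEq_of_mgf_eq_exp hJ (hmgf L hL) hs).iteratedDeriv_eq 2]
      exact iteratedDeriv_const_mul_field _ _
    have h := one_sub_mul_exp_le_measureReal_nonpos hX
      (mem_interior_integrableExpSet_of_mgf_eq_exp hJ (hmgf L hL) hs) (hlt.le.trans hle)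
      (by rw [hd1]; exact mul_neg_of_pos_of_neg hL' hm)
    have e : (L : ℝ) * iteratedDeriv 2 Λ s / (L * Λ' s) ^ 2 = K / L := by
      rw [hK]
      field_simp [hm.ne]
    rw [hd2, hd1, e, (cgf_eventuallyEq_of_mgf_eq_exp hJ (hmgf L hL) hs).eq_of_nhds] at h
    have h' : 2⁻¹ * Real.exp (L * Λ s - 2 * s * (L * Λ' s)) ≤ (μ L).real {ω | X ω ≤ 0} :=
      le_trans (mul_le_mul_of_nonneg_right (by linarith) (Real.exp_pos _).le) h
    have hlog := Real.log_le_log (by positivity) h'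
    rw [Real.log_mul (by norm_num) (Real.exp_pos _).ne', Real.log_exp, Real.log_inv] at hlog
    have := mul_le_mul_of_nonneg_left hlog (by positivity : 0 ≤ 1 / (L : ℝ))
    have e : 1 / (L : ℝ) * (-Real.log 2 + (L * Λ s - 2 * s * (L * Λ' s)))
        = -(Real.log 2 / L + (-Λ s + 2 * s * Λ' s)) := by field_simp; ring
    linarith

end Cramer

/-! ### Moment generating functions of noncentral chi-square laws -/

/-- Completing the square: `exp (s * z ^ 2)` times the density of `N(m, 1)` is a multiple of the
density of `N(m / (1 - 2 * s), 1 / (1 - 2 * s))`. -/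
theorem gaussianPDFReal_mul_exp_sq (m z : ℝ) {s : ℝ} (hs : s < 1 / 2) :
    gaussianPDFReal m 1 z * Real.exp (s * z ^ 2) =
      Real.exp (-(1 / 2) * Real.log (1 - 2 * s) + m ^ 2 * s / (1 - 2 * s)) *
        gaussianPDFReal (m / (1 - 2 * s)) (1 - 2 * s)⁻¹.toNNReal z := by
  have h : 0 < 1 - 2 * s := by linarith
  have hroot : Real.exp (-(1 / 2) * Real.log (1 - 2 * s)) = (√(1 - 2 * s))⁻¹ := by
    rw [← Real.exp_log (Real.sqrt_pos.2 h), ← Real.exp_neg, Real.log_sqrt h.le]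
    ring_nf
  rw [gaussianPDFReal, gaussianPDFReal, Real.coe_toNNReal _ (inv_pos.2 h).le, Real.exp_add, hroot,
    Real.sqrt_mul (by positivity) (1 - 2 * s)⁻¹, Real.sqrt_inv]
  have hne : √(1 - 2 * s) ≠ 0 := (Real.sqrt_pos.2 h).ne'
  have hexp : Real.exp (m ^ 2 * s / (1 - 2 * s)) *
      Real.exp (-(z - m / (1 - 2 * s)) ^ 2 / (2 * (1 - 2 * s)⁻¹)) =
      Real.exp (-(z - m) ^ 2 / (2 * 1)) * Real.exp (s * z ^ 2) := by
    rw [← Real.exp_add, ← Real.exp_add]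
    congr 1
    obtain ⟨q, rfl⟩ : ∃ q, s = (1 - q) / 2 := ⟨1 - 2 * s, by ring⟩
    have e : 1 - 2 * ((1 - q) / 2) = q := by ring
    rw [e] at h ⊢
    field_simp
    ring
  calc _ = (√(2 * Real.pi))⁻¹ *
        (Real.exp (-(z - m) ^ 2 / (2 * 1)) * Real.exp (s * z ^ 2)) := by
        simp [mul_assoc]
    _ = _ := by
        rw [← hexp]
        field_simp

theorem integral_exp_sq_gaussianReal (m : ℝ) {s : ℝ} (hs : s < 1 / 2) :
    ∫ z, Real.exp (s * z ^ 2) ∂(gaussianReal m 1) =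
      Real.exp (-(1 / 2) * Real.log (1 - 2 * s) + m ^ 2 * s / (1 - 2 * s)) := by
  have h : 0 < 1 - 2 * s := by linarith
  rw [integral_gaussianReal_eq_integral_smul one_ne_zero]
  simp_rw [smul_eq_mul, gaussianPDFReal_mul_exp_sq m _ hs]
  rw [integral_const_mul, integral_gaussianPDFReal_eq_one _ (by simpa using h), mul_one]

theorem mgf_noncentralChiSq {n : ℕ} (hn : n ≠ 0) {lam : ℝ} (hlam : 0 ≤ lam) {s : ℝ}
    (hs : s < 1 / 2) :
    mgf id (noncentralChiSq n lam) s =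
      Real.exp (-(n / 2) * Real.log (1 - 2 * s) + lam * s / (1 - 2 * s)) := by
  have hn' : (n : ℝ) ≠ 0 := by exact_mod_cast hn
  rw [noncentralChiSq, mgf_id_map (Measurable.aemeasurable (by fun_prop)), mgf]
  simp_rw [Finset.mul_sum, Real.exp_sum]
  rw [integral_fintype_prod_eq_pow (fun z : ℝ => Real.exp (s * z ^ 2)),
    integral_exp_sq_gaussianReal _ hs, Fintype.card_fin, ← Real.exp_nat_mul,
    Real.sq_sqrt (by positivity)]
  congr 1
  have h : 1 - 2 * s ≠ 0 := by linarith
  field_simp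

/-- The moment generating function of `U - γ V` for independent noncentral chi-square variables. -/
theorem mgf_fst_sub_mul_snd {n₁ n₂ : ℕ} (hn₁ : n₁ ≠ 0) (hn₂ : n₂ ≠ 0) {lam γ s : ℝ}
    (hlam : 0 ≤ lam) (hs : s < 1 / 2) (hs' : 0 < 1 + 2 * γ * s) :
    mgf (fun p : ℝ × ℝ => p.1 - γ * p.2)
        ((noncentralChiSq n₁ lam).prod (noncentralChiSq n₂ 0)) s =
      Real.exp (-(n₁ / 2) * Real.log (1 - 2 * s) + lam * s / (1 - 2 * s)
        - n₂ / 2 * Real.log (1 + 2 * γ * s)) := by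
  have e : ∀ p : ℝ × ℝ, Real.exp (s * (p.1 - γ * p.2)) =
      Real.exp (s * p.1) * Real.exp (-(γ * s) * p.2) := fun p => by
    rw [← Real.exp_add]
    ring_nf
  have h1 := mgf_noncentralChiSq hn₁ hlam hs
  have h2 := mgf_noncentralChiSq hn₂ le_rfl (s := -(γ * s)) (by linarith)
  simp only [mgf, id] at h1 h2 ⊢
  simp_rw [e]
  rw [integral_prod_mul (fun x => Real.exp (s * x)) (fun y => Real.exp (-(γ * s) * y)), h1, h2,
    ← Real.exp_add]
  congr 1
  ring_nf

theorem noncentralChiSq_ae_pos {n : ℕ} (hn : n ≠ 0) (lam : ℝ) :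
    ∀ᵐ v ∂(noncentralChiSq n lam), 0 < v := by
  rw [noncentralChiSq, ae_map_iff (Measurable.aemeasurable (by fun_prop)) measurableSet_Ioi]
  have : NeZero n := ⟨hn⟩
  have hnull : NullSingletonClass (gaussianReal √(lam / n) 1) :=
    nullSingletonClass_gaussianReal one_ne_zero
  have h : ∀ᵐ x ∂(gaussianReal √(lam / n) 1), x ≠ 0 :=
    compl_mem_ae_iff.2 (measure_singleton 0)
  have h' := (measurePreserving_eval (fun _ : Fin n => gaussianReal √(lam / n) 1)
    0).quasiMeasurePreserving.ae h
  filter_upwards [h'] with z hz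
  exact (by positivity : 0 < z 0 ^ 2).trans_le
    (Finset.single_le_sum (f := fun i => z i ^ 2) (fun i _ => sq_nonneg _) (Finset.mem_univ 0))

/-- The value at `n₂ / n₁ * γ` of the distribution function of the noncentral `F`-distribution is
the probability that `U ≤ γ V`, since the denominator `V` is a.s. positive. -/
theorem cdf_noncentralF {n₁ n₂ : ℕ} (hn₁ : n₁ ≠ 0) (hn₂ : n₂ ≠ 0) (lam γ : ℝ) :
    cdf (noncentralF n₁ n₂ lam) (n₂ / n₁ * γ) =
      ((noncentralChiSq n₁ lam).prod (noncentralChiSq n₂ 0)).real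
        {p : ℝ × ℝ | p.1 - γ * p.2 ≤ 0} := by
  have h₁ : (0 : ℝ) < n₁ := by positivity
  have h₂ : (0 : ℝ) < n₂ := by positivity
  rw [cdf_eq_real, noncentralF, map_measureReal_apply (by fun_prop) measurableSet_Iic]
  refine measureReal_congr ?_
  have hpos : ∀ᵐ p ∂((noncentralChiSq n₁ lam).prod (noncentralChiSq n₂ 0)), 0 < p.2 :=
    Measure.quasiMeasurePreserving_snd.ae (noncentralChiSq_ae_pos hn₂ 0)
  filter_upwards [hpos] with p hp
  refine propext ?_
  change p.1 / n₁ / (p.2 / n₂) ≤ n₂ / n₁ * γ ↔ p.1 - γ * p.2 ≤ 0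
  rw [div_le_iff₀ (by positivity), div_le_iff₀ h₁, sub_nonpos]
  have e : (n₂ : ℝ) / n₁ * γ * (p.2 / n₂) * n₁ = γ * p.2 := by field_simp
  rw [e]

/-! ### The cumulant generating function per slot -/

/-- The cumulant generating function of `U - γ V` for one slot, where `U` is noncentral chi-square
with `2 N` degrees of freedom and noncentrality `η`, and `V` is central chi-square with `2 M`
degrees of freedom. Only its values on `slotDomain γ` are meaningful. -/
noncomputable def slotCgf (N M γ η s : ℝ) : ℝ :=
  -N * Real.log (1 - 2 * s) + η * s / (1 - 2 * s) - M * Real.log (1 + 2 * γ * s)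

/-- The derivative of `slotCgf` on `slotDomain γ`. -/
noncomputable def slotCgfDeriv (N M γ η s : ℝ) : ℝ :=
  2 * N / (1 - 2 * s) + η / (1 - 2 * s) ^ 2 - 2 * γ * M / (1 + 2 * γ * s)

/-- The interval on which the moment generating function of `U - γ V` is finite. -/
def slotDomain (γ : ℝ) : Set ℝ := {s | 0 < 1 - 2 * s ∧ 0 < 1 + 2 * γ * s}

theorem isOpen_slotDomain (γ : ℝ) : IsOpen (slotDomain γ) := by
  have h₁ : IsOpen {s : ℝ | 0 < 1 - 2 * s} := isOpen_lt continuous_const (by fun_prop)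
  have h₂ : IsOpen {s : ℝ | 0 < 1 + 2 * γ * s} := isOpen_lt continuous_const (by fun_prop)
  exact h₁.inter h₂

theorem convex_slotDomain (γ : ℝ) : Convex ℝ (slotDomain γ) := by
  rintro x ⟨hx, hx'⟩ y ⟨hy, hy'⟩ a b ha hb hab
  obtain rfl : b = 1 - a := by linarith
  simp only [slotDomain, smul_eq_mul, mem_ofPred_eq]
  rcases ha.eq_or_lt with rfl | ha
  · constructor <;> linarith
  · constructor
    · nlinarith [mul_pos ha hx, mul_nonneg hb hy.le]
    · nlinarith [mul_pos ha hx', mul_nonneg hb hy'.le]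

theorem zero_mem_slotDomain (γ : ℝ) : (0 : ℝ) ∈ slotDomain γ := by simp [slotDomain]

variable {N M γ η s : ℝ}

theorem hasDerivAt_slotCgf (hs : s ∈ slotDomain γ) :
    HasDerivAt (slotCgf N M γ η) (slotCgfDeriv N M γ η s) s := by
  obtain ⟨h1, h2⟩ := hs
  have d1 : HasDerivAt (fun s : ℝ => 1 - 2 * s) (-2) s := by
    simpa using ((hasDerivAt_id s).const_mul 2).const_sub 1
  have d2 : HasDerivAt (fun s : ℝ => 1 + 2 * γ * s) (2 * γ) s := by
    simpa using ((hasDerivAt_id s).const_mul (2 * γ)).const_add 1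
  have d3 : HasDerivAt (fun s : ℝ => η * s) η s := by
    simpa using (hasDerivAt_id s).const_mul η
  convert! (((d1.log h1.ne').const_mul (-N)).add (d3.div d1 h1.ne')).sub
    ((d2.log h2.ne').const_mul M) using 1
  rw [slotCgfDeriv]
  field_simp
  ring

theorem strictMonoOn_slotCgfDeriv (hN : 0 < N) (hM : 0 < M) (hγ : 0 < γ) (hη : 0 < η) :
    StrictMonoOn (slotCgfDeriv N M γ η) (slotDomain γ) := by
  rintro s ⟨h1, h2⟩ t ⟨h3, h4⟩ hst
  have e1 : 2 * N / (1 - 2 * s) < 2 * N / (1 - 2 * t) := by gcongr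
  have e2 : η / (1 - 2 * s) ^ 2 < η / (1 - 2 * t) ^ 2 := by gcongr
  have e3 : 2 * γ * M / (1 + 2 * γ * t) < 2 * γ * M / (1 + 2 * γ * s) := by gcongr
  rw [slotCgfDeriv, slotCgfDeriv]
  linarith

theorem continuousAt_slotCgfDeriv (hs : s ∈ slotDomain γ) :
    ContinuousAt (slotCgfDeriv N M γ η) s := by
  obtain ⟨h1, h2⟩ := hs
  unfold slotCgfDeriv
  have := h1.ne'
  have := h2.ne'
  fun_prop (disch := first | assumption | exact pow_ne_zero _ ‹_›)

theorem slotCgf_le_of_deriv_eq_zero (hN : 0 < N) (hM : 0 < M) (hγ : 0 < γ) (hη : 0 < η) {s₀ : ℝ}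
    (hs₀ : s₀ ∈ slotDomain γ) (h0 : slotCgfDeriv N M γ η s₀ = 0) (hs : s ∈ slotDomain γ) :
    slotCgf N M γ η s₀ ≤ slotCgf N M γ η s := by
  have hint : interior (slotDomain γ) = slotDomain γ := (isOpen_slotDomain γ).interior_eq
  have hconv : ConvexOn ℝ (slotDomain γ) (slotCgf N M γ η) := by
    refine MonotoneOn.convexOn_of_deriv (convex_slotDomain γ)
      (fun u hu => (hasDerivAt_slotCgf hu).continuousAt.continuousWithinAt)
      (fun u hu => (hasDerivAt_slotCgf (interior_subset hu)).differentiableAt.differentiableWithinAt)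
      ?_
    rw [hint]
    exact (strictMonoOn_slotCgfDeriv hN hM hγ hη).monotoneOn.congr
      fun u hu => (hasDerivAt_slotCgf hu).deriv.symm
  refine hconv.isMinOn_of_rightDeriv_eq_zero (by rwa [hint]) ?_ hs
  rw [(hasDerivAt_slotCgf hs₀).hasDerivWithinAt.derivWithin (uniqueDiffWithinAt_Ioi s₀), h0]

theorem slotCgf_strictAnti_noncentrality {η₁ η₂ : ℝ} (hη : η₁ < η₂) (hs : s ∈ slotDomain γ)
    (hneg : s < 0) : slotCgf N M γ η₂ s < slotCgf N M γ η₁ s := by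
  have : s / (1 - 2 * s) < 0 := div_neg_of_neg_of_pos hneg hs.1
  have := mul_lt_mul_of_neg_right hη this
  rw [slotCgf, slotCgf, mul_div_assoc, mul_div_assoc]
  linarith

/-! ### The rate equation and its positive root -/

section Root

variable {NR Ns : ℕ} {x : ℝ}

theorem mul_sub_one_pos (hNR : 1 ≤ NR) (hNs : 2 ≤ Ns) : 0 < (NR : ℝ) * ((Ns : ℝ) - 1) := by
  have hN : (1 : ℝ) ≤ NR := by exact_mod_cast hNR
  have hs : (2 : ℝ) ≤ Ns := by exact_mod_cast hNs
  exact mul_pos (by linarith) (by linarith)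

theorem existsUnique_isRateRoot (hNR : 1 ≤ NR) (hNs : 2 ≤ Ns) (hγ : 0 < γ) (hη : 0 < η) :
    ∃! x : ℝ, IsRateRoot NR Ns γ η x := by
  have hN : (1 : ℝ) ≤ NR := by exact_mod_cast hNR
  have hM : 0 < (NR : ℝ) * ((Ns : ℝ) - 1) := mul_sub_one_pos hNR hNs
  set a := (γ + 1) / (η * γ) with ha
  have ha0 : 0 < a := by positivity
  set c := a * (NR : ℝ) ^ 2 + NR + 2 * NR * ((Ns : ℝ) - 1) with hc
  have hc0 : 0 < c := by
    have : 0 ≤ a * (NR : ℝ) ^ 2 := by positivity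
    linarith
  have key : ∀ x, IsRateRoot NR Ns γ η x ↔ 0 < x ∧ a * x ^ 2 - x = c := fun x => by
    rw [IsRateRoot, ← ha, hc]
    refine and_congr_right fun _ => ?_
    constructor <;> intro h <;> linarith
  simp_rw [key]
  have hr : √(1 + 4 * a * c) ^ 2 = 1 + 4 * a * c := Real.sq_sqrt (by positivity)
  refine ⟨(1 + √(1 + 4 * a * c)) / (2 * a), ⟨by positivity, ?_⟩, ?_⟩
  · have hr0 := Real.sqrt_nonneg (1 + 4 * a * c)
    generalize √(1 + 4 * a * c) = r at hr hr0
    field_simp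
    linear_combination hr
  · rintro y ⟨hy, hyc⟩
    have h1 : (2 * a * y - 1) ^ 2 = √(1 + 4 * a * c) ^ 2 := by
      rw [hr, ← hyc]
      ring
    have h2 : 0 ≤ 2 * a * y - 1 := by
      -- `y * (a * y - 1) = c > 0`
      have : 0 < y * (a * y - 1) := by linarith
      have := (pos_iff_pos_of_mul_pos this).1 hy
      nlinarith [mul_pos ha0 hy]
    have h3 := (pow_left_inj₀ h2 (Real.sqrt_nonneg _) two_ne_zero).1 h1
    rw [← h3]
    field_simp
    ring

theorem isRateRoot_xStar (hNR : 1 ≤ NR) (hNs : 2 ≤ Ns) (hγ : 0 < γ) (hη : 0 < η) :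
    IsRateRoot NR Ns γ η (xStar NR Ns γ η) :=
  Classical.epsilon_spec (existsUnique_isRateRoot hNR hNs hγ hη).exists

theorem IsRateRoot.natCast_lt (hNs : 2 ≤ Ns) (hγ : 0 < γ) (hη : 0 < η)
    (hx : IsRateRoot NR Ns γ η x) : (NR : ℝ) < x := by
  obtain ⟨hx0, hx⟩ := hx
  have hs : (2 : ℝ) ≤ Ns := by exact_mod_cast hNs
  have h0 : (0 : ℝ) ≤ NR := Nat.cast_nonneg _
  have hM : 0 ≤ (NR : ℝ) * ((Ns : ℝ) - 1) := mul_nonneg h0 (by linarith)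
  have ha : 0 < (γ + 1) / (η * γ) := by positivity
  have h : 0 < (γ + 1) / (η * γ) * (x ^ 2 - (NR : ℝ) ^ 2) := by linarith
  have h' := (pos_iff_pos_of_mul_pos h).1 ha
  exact lt_of_pow_lt_pow_left₀ 2 hx0.le (by linarith)

/-- The rate equation in terms of `w = (x - N_R) / η`, factored. -/
theorem IsRateRoot.factored (hγ : 0 < γ) (hη : 0 < η) (hx : IsRateRoot NR Ns γ η x) :
    ((γ + 1) * ((x - NR) / η) - γ) * (x + NR) = 2 * γ * (NR * ((Ns : ℝ) - 1)) := by
  have h := hx.2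
  field_simp at h ⊢
  linarith

/-- The critical point of the cumulant generating function, determined by
`1 / (1 - 2 * s) = (x - N_R) / η` for the positive root `x` of the rate equation. -/
noncomputable def critPoint (NR : ℕ) (η x : ℝ) : ℝ := (1 - η / (x - NR)) / 2

theorem one_sub_two_mul_critPoint : 1 - 2 * critPoint NR η x = η / (x - NR) := by
  rw [critPoint]
  ring

theorem one_add_mul_critPoint (hNs : 2 ≤ Ns) (hγ : 0 < γ) (hη : 0 < η)
    (hx : IsRateRoot NR Ns γ η x) :
    1 + 2 * γ * critPoint NR η x =
      2 * γ * (NR * ((Ns : ℝ) - 1)) * η / ((x - NR) * (x + NR)) := by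
  have h1 : 0 < x - NR := sub_pos.2 (hx.natCast_lt hNs hγ hη)
  have h2 : 0 < x + NR := add_pos_of_pos_of_nonneg hx.1 (Nat.cast_nonneg _)
  rw [← hx.factored hγ hη, critPoint]
  field_simp
  ring

theorem critPoint_mem_slotDomain (hNR : 1 ≤ NR) (hNs : 2 ≤ Ns) (hγ : 0 < γ) (hη : 0 < η)
    (hx : IsRateRoot NR Ns γ η x) : critPoint NR η x ∈ slotDomain γ := by
  have hN : (1 : ℝ) ≤ NR := by exact_mod_cast hNR
  have hM : 0 < (NR : ℝ) * ((Ns : ℝ) - 1) := mul_sub_one_pos hNR hNs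
  have h1 : 0 < x - NR := sub_pos.2 (hx.natCast_lt hNs hγ hη)
  have h2 : 0 < x + NR := by linarith [hx.1]
  refine ⟨?_, ?_⟩
  · rw [one_sub_two_mul_critPoint]
    positivity
  · rw [one_add_mul_critPoint hNs hγ hη hx]
    positivity

theorem slotCgfDeriv_critPoint (hNR : 1 ≤ NR) (hNs : 2 ≤ Ns) (hγ : 0 < γ) (hη : 0 < η)
    (hx : IsRateRoot NR Ns γ η x) :
    slotCgfDeriv NR (NR * ((Ns : ℝ) - 1)) γ η (critPoint NR η x) = 0 := by
  have hN : (1 : ℝ) ≤ NR := by exact_mod_cast hNR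
  have hM : 0 < (NR : ℝ) * ((Ns : ℝ) - 1) := mul_sub_one_pos hNR hNs
  have h1 : 0 < x - NR := sub_pos.2 (hx.natCast_lt hNs hγ hη)
  have h2 : 0 < x + NR := by linarith [hx.1]
  rw [slotCgfDeriv, one_sub_two_mul_critPoint, one_add_mul_critPoint hNs hγ hη hx]
  generalize (NR : ℝ) * ((Ns : ℝ) - 1) = M at hM ⊢
  field_simp
  ring

/-- The critical point is negative exactly when the slope at `0` is positive, i.e. when the mean
of `U - γ V` is positive; this is the condition that `γ` lies below the critical threshold. -/
theorem critPoint_neg_iff (hNR : 1 ≤ NR) (hNs : 2 ≤ Ns) (hγ : 0 < γ) (hη : 0 < η)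
    (hx : IsRateRoot NR Ns γ η x) :
    critPoint NR η x < 0 ↔ 0 < slotCgfDeriv NR (NR * ((Ns : ℝ) - 1)) γ η 0 := by
  have hN : (1 : ℝ) ≤ NR := by exact_mod_cast hNR
  have hmono := strictMonoOn_slotCgfDeriv (N := NR) (M := NR * ((Ns : ℝ) - 1)) (by linarith)
    (mul_sub_one_pos hNR hNs) hγ hη
  have h := hmono.lt_iff_lt (critPoint_mem_slotDomain hNR hNs hγ hη hx) (zero_mem_slotDomain γ)
  rw [slotCgfDeriv_critPoint hNR hNs hγ hη hx] at h
  exact h.symm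

theorem lt_criticalThreshold_iff (hNR : 1 ≤ NR) (hNs : 2 ≤ Ns) :
    γ < criticalThreshold NR Ns η ↔ 0 < slotCgfDeriv NR (NR * ((Ns : ℝ) - 1)) γ η 0 := by
  have hM : 0 < 2 * (NR : ℝ) * ((Ns : ℝ) - 1) := by linarith [mul_sub_one_pos hNR hNs]
  rw [criticalThreshold, lt_div_iff₀ hM, slotCgfDeriv, ← sub_pos]
  ring_nf

theorem rateStar_eq_neg_slotCgf (hNR : 1 ≤ NR) (hNs : 2 ≤ Ns) (hγ : 0 < γ) (hη : 0 < η) :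
    rateStar NR Ns γ η =
      -slotCgf NR (NR * ((Ns : ℝ) - 1)) γ η (critPoint NR η (xStar NR Ns γ η)) := by
  have hx := isRateRoot_xStar hNR hNs hγ hη
  have hw : γ * vStar NR Ns γ η / (NR + √((NR : ℝ) ^ 2 + γ * η * vStar NR Ns γ η)) =
      (xStar NR Ns γ η - NR) / η := by
    have e : (NR : ℝ) ^ 2 + γ * η * vStar NR Ns γ η = xStar NR Ns γ η ^ 2 := by
      rw [vStar]
      field_simp
      ring
    rw [e, Real.sqrt_sq hx.1.le, vStar]
    have : (NR : ℝ) + xStar NR Ns γ η ≠ 0 :=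
      (add_pos_of_nonneg_of_pos (Nat.cast_nonneg _) hx.1).ne'
    field_simp
    ring
  rw [rateStar, hw, slotCgf, one_sub_two_mul_critPoint, one_add_mul_critPoint hNs hγ hη hx, vStar]
  have h1 : 0 < xStar NR Ns γ η - NR := sub_pos.2 (hx.natCast_lt hNs hγ hη)
  have h2 : 0 < xStar NR Ns γ η + NR := add_pos_of_pos_of_nonneg hx.1 (Nat.cast_nonneg _)
  generalize xStar NR Ns γ η = x at *
  have e1 : 2 * NR * ((Ns : ℝ) - 1) / ((x ^ 2 - (NR : ℝ) ^ 2) / (η * γ)) =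
      2 * γ * (NR * ((Ns : ℝ) - 1)) * η / ((x - NR) * (x + NR)) := by
    rw [sq_sub_sq, mul_comm (x + (NR : ℝ))]
    field_simp
  have e2 : Real.log (η / (x - NR)) = -Real.log ((x - NR) / η) := by
    rw [← Real.log_inv, inv_div]
  have e3 : η * critPoint NR η x / (η / (x - NR)) = -(η / 2 * (1 - (x - NR) / η)) := by
    rw [critPoint]
    field_simp
    ring
  rw [e1, e2, e3]
  ring

end Root

/-! ### The miss-detection probability -/

section Miss

variable {NR Ns : ℕ} {γ η : ℝ}

/-- The joint law of `(U, V)` over `L` slots. -/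
noncomputable def slotLaw (NR Ns : ℕ) (η : ℝ) (L : ℕ) : Measure (ℝ × ℝ) :=
  (noncentralChiSq (2 * NR * L) (L * η)).prod (noncentralChiSq (2 * NR * L * (Ns - 1)) 0)

instance (NR Ns : ℕ) (η : ℝ) (L : ℕ) : IsProbabilityMeasure (slotLaw NR Ns η L) := by
  rw [slotLaw]
  infer_instance

theorem mgf_slotLaw (hNR : 1 ≤ NR) (hNs : 2 ≤ Ns) (hη : 0 < η) {L : ℕ} (hL : 1 ≤ L) {s : ℝ}
    (hs : s ∈ slotDomain γ) :
    mgf (fun p : ℝ × ℝ => p.1 - γ * p.2) (slotLaw NR Ns η L) s =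
      Real.exp (L * slotCgf NR (NR * ((Ns : ℝ) - 1)) γ η s) := by
  have h₁ : 2 * NR * L ≠ 0 := by positivity
  have h₂ : 2 * NR * L * (Ns - 1) ≠ 0 := mul_ne_zero h₁ (by omega)
  rw [slotLaw, mgf_fst_sub_mul_snd h₁ h₂ (by positivity) (by linarith [hs.1]) hs.2, slotCgf]
  push_cast [Nat.cast_sub (by omega : 1 ≤ Ns)]
  congr 1
  ring

theorem missProb_eq (hNR : 1 ≤ NR) (hNs : 2 ≤ Ns) {L : ℕ} (hL : 1 ≤ L) :
    missProb NR Ns γ η L = (slotLaw NR Ns η L).real {p : ℝ × ℝ | p.1 - γ * p.2 ≤ 0} := by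
  have h₁ : 2 * NR * L ≠ 0 := by positivity
  have h₂ : 2 * NR * L * (Ns - 1) ≠ 0 := mul_ne_zero h₁ (by omega)
  rw [missProb, slotLaw, ← cdf_noncentralF h₁ h₂]
  congr 2
  have h₃ : ((2 * NR * L : ℕ) : ℝ) ≠ 0 := by exact_mod_cast h₁
  rw [Nat.cast_mul (2 * NR * L), mul_div_cancel_left₀ _ h₃, Nat.cast_sub (by omega : 1 ≤ Ns),
    Nat.cast_one]

theorem missProb_pos (hNR : 1 ≤ NR) (hNs : 2 ≤ Ns) (hγ : 0 < γ) (hη : 0 < η) {L : ℕ}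
    (hL : 1 ≤ L) : 0 < missProb NR Ns γ η L := by
  have hN : (1 : ℝ) ≤ NR := by exact_mod_cast hNR
  have hM : 0 < (NR : ℝ) * ((Ns : ℝ) - 1) := mul_sub_one_pos hNR hNs
  have hx := isRateRoot_xStar hNR hNs hγ hη
  have hc := critPoint_mem_slotDomain hNR hNs hγ hη hx
  -- the slope is negative immediately to the left of the critical point
  obtain ⟨s, hs, hlt⟩ :=
    ((((isOpen_slotDomain γ).eventually_mem hc).filter_mono nhdsWithin_le_nhds).and
      (self_mem_nhdsWithin (s := Iio (critPoint NR η (xStar NR Ns γ η))))).exists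
  rw [missProb_eq hNR hNs hL]
  refine measureReal_nonpos_pos_of_mgf_eq_exp (isOpen_slotDomain γ)
    (fun s hs => mgf_slotLaw hNR hNs hη hL hs) (by exact_mod_cast hL) hs (hasDerivAt_slotCgf hs) ?_
  rw [← slotCgfDeriv_critPoint hNR hNs hγ hη hx]
  exact strictMonoOn_slotCgfDeriv (by linarith) hM hγ hη hs hc hlt

/-- The hypotheses on `s₀` say that it minimizes `slotCgf` over the nonpositive part of
`slotDomain γ`. -/
theorem tendsto_neg_log_missProb (hNR : 1 ≤ NR) (hNs : 2 ≤ Ns) (hγ : 0 < γ) (hη : 0 < η) {s₀ : ℝ}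
    (hs₀ : s₀ ∈ slotDomain γ) (hle : s₀ ≤ 0)
    (hslope : slotCgfDeriv NR (NR * ((Ns : ℝ) - 1)) γ η s₀ ≤ 0)
    (hcrit : s₀ * slotCgfDeriv NR (NR * ((Ns : ℝ) - 1)) γ η s₀ = 0) :
    Tendsto (fun L : ℕ => -(1 / (L : ℝ)) * Real.log (missProb NR Ns γ η L)) atTop
      (𝓝 (-slotCgf NR (NR * ((Ns : ℝ) - 1)) γ η s₀)) := by
  have hN : (1 : ℝ) ≤ NR := by exact_mod_cast hNR
  have hM : 0 < (NR : ℝ) * ((Ns : ℝ) - 1) := mul_sub_one_pos hNR hNs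
  refine (tendsto_neg_log_measureReal_nonpos (μ := slotLaw NR Ns η)
    (X := fun p : ℝ × ℝ => p.1 - γ * p.2) (by fun_prop)
    (isOpen_slotDomain γ) (fun L hL s hs => mgf_slotLaw hNR hNs hη hL hs)
    (fun s hs => hasDerivAt_slotCgf hs) (strictMonoOn_slotCgfDeriv (by linarith) hM hγ hη) hs₀
    (continuousAt_slotCgfDeriv hs₀) hle hslope hcrit).congr' ?_
  filter_upwards [eventually_ge_atTop 1] with L hL
  rw [missProb_eq hNR hNs hL]

theorem strictMonoOn_rateStar (hNR : 1 ≤ NR) (hNs : 2 ≤ Ns) (hγ : 0 < γ) :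
    StrictMonoOn (fun η : ℝ => rateStar NR Ns γ η)
      {η : ℝ | 0 < η ∧ γ < criticalThreshold NR Ns η} := by
  have hN : (1 : ℝ) ≤ NR := by exact_mod_cast hNR
  have hM : 0 < (NR : ℝ) * ((Ns : ℝ) - 1) := mul_sub_one_pos hNR hNs
  rintro η₁ ⟨h₁, hlt₁⟩ η₂ ⟨h₂, -⟩ hlt
  have hx₁ := isRateRoot_xStar hNR hNs hγ h₁
  have hx₂ := isRateRoot_xStar hNR hNs hγ h₂
  have hc₁ := critPoint_mem_slotDomain hNR hNs hγ h₁ hx₁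
  have hneg := (critPoint_neg_iff hNR hNs hγ h₁ hx₁).2 ((lt_criticalThreshold_iff hNR hNs).1 hlt₁)
  simp only [rateStar_eq_neg_slotCgf hNR hNs hγ h₁, rateStar_eq_neg_slotCgf hNR hNs hγ h₂]
  -- compare both rates with the value for `η₂` at the critical point for `η₁`
  have e₁ := slotCgf_strictAnti_noncentrality (N := NR) (M := NR * ((Ns : ℝ) - 1)) hlt hc₁ hneg
  have e₂ := slotCgf_le_of_deriv_eq_zero (by linarith) hM hγ h₂
    (critPoint_mem_slotDomain hNR hNs hγ h₂ hx₂) (slotCgfDeriv_critPoint hNR hNs hγ h₂ hx₂) hc₁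
  linarith

end Miss

end MissDetection

theorem proposition3 (NR Ns : ℕ) (hNR : 1 ≤ NR) (hNs : 2 ≤ Ns) (γ : ℝ) (hγ : 0 < γ) :
    (∀ η : ℝ, 0 < η →
      (∃! x : ℝ, MissDetection.IsRateRoot NR Ns γ η x) ∧
      (∀ L : ℕ, 1 ≤ L → 0 < MissDetection.missProb NR Ns γ η L) ∧
      (γ < MissDetection.criticalThreshold NR Ns η →
        Filter.Tendsto
          (fun L : ℕ => -(1 / (L : ℝ)) * Real.log (MissDetection.missProb NR Ns γ η L))
          Filter.atTop (nhds (MissDetection.rateStar NR Ns γ η))) ∧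
      (¬ γ < MissDetection.criticalThreshold NR Ns η →
        Filter.Tendsto
          (fun L : ℕ => -(1 / (L : ℝ)) * Real.log (MissDetection.missProb NR Ns γ η L))
          Filter.atTop (nhds 0))) ∧
    StrictMonoOn (fun η : ℝ => MissDetection.rateStar NR Ns γ η)
      {η : ℝ | 0 < η ∧ γ < MissDetection.criticalThreshold NR Ns η} := by
  refine ⟨fun η hη => ⟨MissDetection.existsUnique_isRateRoot hNR hNs hγ hη,
    fun L hL => MissDetection.missProb_pos hNR hNs hγ hη hL, fun hlt => ?_, fun hge => ?_⟩,
    MissDetection.strictMonoOn_rateStar hNR hNs hγ⟩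
  · have hx := MissDetection.isRateRoot_xStar hNR hNs hγ hη
    have h0 := MissDetection.slotCgfDeriv_critPoint hNR hNs hγ hη hx
    rw [MissDetection.rateStar_eq_neg_slotCgf hNR hNs hγ hη]
    exact MissDetection.tendsto_neg_log_missProb hNR hNs hγ hη
      (MissDetection.critPoint_mem_slotDomain hNR hNs hγ hη hx)
      ((MissDetection.critPoint_neg_iff hNR hNs hγ hη hx).2
        ((MissDetection.lt_criticalThreshold_iff hNR hNs).1 hlt)).le
      h0.le (by rw [h0, mul_zero])
  · rw [MissDetection.lt_criticalThreshold_iff hNR hNs, not_lt] at hge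
    simpa [MissDetection.slotCgf] using MissDetection.tendsto_neg_log_missProb hNR hNs hγ hη
      (MissDetection.zero_mem_slotDomain γ) le_rfl hge (zero_mul _)
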